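/- **Setting.** Let $\Omega$ be a finite set of states with a $\sigma$-algebra $\mathcal F$ of events, $(T,\Sigma,\mu)$ a complete, finite, positive, atomless measure space of agents (every $A\in\Sigma$ with $\mu(A)>0$ has a subset $B\in\Sigma$ with $0<\mu(B)<\mu(A)$), and $Y$ an ordered Banach space (a real Banach space with a partial order compatible with addition and with multiplication by nonnegative reals) whose positive cone $Y_+=\{x\in Y: x\ge 0\}$ has nonempty norm interior. Write $x\gg 0$ if $x$ is an interior point of $Y_+$. Each agent $t\in T$ has a partition $\Pi_t$ of $\Omega$, generating the $\sigma$-algebra $\mathcal F_t$; a utility function $U_t:\Omega\times Y_+\to\mathbb R$; an endowment $a(t,\cdot):\Omega\to Y_+$ that is constant on each cell of $\Pi_t$; and a prior $q_t$, a probability on $\Omega$ with $q_t(\omega)>0$ for all $\omega$. Each $a(\cdot,\omega)$ is Bochner integrable over $T$. For $x:\Omega\to Y_+$ put $V_t(x)=\sum_{\omega\in\Omega}U_t(\omega,x(\omega))\,q_t(\omega)$. A *coalition* is a set $S\in\Sigma$ with $\mu(S)>0$. An *$S$-allocation* is a function $g:S\times\Omega\to Y_+$ such that $g(\cdot,\omega)$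 is Bochner integrable over $S$ for every $\omega$ and $g(t,\cdot)$ is $\mathcal F_t$-measurable for almost all $t\in S$. It is *$S$-exactly feasible* if $\int_S g(\cdot,\omega)\,d\mu=\int_S a(\cdot,\omega)\,d\mu$ for all $\omega\in\Omega$. For $S=T$ one speaks of allocations and exactly feasible allocations. An allocation $f$ is *NY-privately blocked* by a coalition $S$ if there is an $S$-exactly feasible $S$-allocation $g$ with $V_t(g(t,\cdot))>V_t(f(t,\cdot))$ for almost all $t\in S$. The *NY-private core* is the set of exactly feasible allocations that are not NY-privately blocked by any coalition. **Assumptions.** - (A$_1$) $t\mapsto q_t$ is Borel measurable, as a map into the simplex of probability vectors on $\Omega$, and $\{t\in T:\Pi_t=\mathcal Q\}\in\Sigma$ for every partition $\mathcal Q$ of $\Omega$. - (A$_2$) For each $\omega$, $t\mapsto U_t(\omega,x)$ is measurable for every $x\in Y_+$, and $x\mapsto U_t(\omega,x)$ is norm-continuous on $Y_+$ for every $t$. - (A$_3$) $U_t(\omega,x+y)>U_t(\omega,x)$ for all $(t,\omega)\in T\times\Omega$ and $x,y\in Y_+$ with $y\gg0$. - (A$_4'$) $U_t(\omega,\cdot)$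 is concave on $Y_+$ for all $(t,\omega)\in T\times\Omega$. - (A$_5$) $a(t,\omega)\gg0$ for all $(t,\omega)\in T\times\Omega$. **Theorem.** Assume (A$_1$), (A$_2$), (A$_3$), (A$_4'$) and (A$_5$). Let $f$ be an exactly feasible allocation that does not belong to the NY-private core, and let $0<\varepsilon<\mu(T)$. Then there is a coalition $S$ with $\mu(S)=\varepsilon$ that NY-privately blocks $f$. -/

import Mathlib

open MeasureTheory

/-- Every measurable set of positive measure contains a measurable subset of strictly smaller,
positive measure. (`MeasureTheory.NoAtoms` only says that singletons are null.) -/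
def MeasureTheory.Measure.Atomless {T : Type*} [MeasurableSpace T] (μ : Measure T) : Prop :=
  ∀ A : Set T, MeasurableSet A → 0 < μ A →
    ∃ B : Set T, B ⊆ A ∧ MeasurableSet B ∧ 0 < μ B ∧ μ B < μ A

/-- `x ≫ 0`: `x` is an interior point of the positive cone `Y₊ = {x | 0 ≤ x}`. -/
def StronglyPos {Y : Type*} [TopologicalSpace Y] [Zero Y] [Preorder Y] (x : Y) : Prop :=
  x ∈ interior (Set.Ici (0 : Y))

/-- A pure exchange economy with asymmetric information: finitely many states `Ω`, agents
`(T, μ)`, commodity space `Y`, consumption set `Y₊` for every agent in every state. -/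
structure AsymEconomy (Ω T Y : Type*) [Fintype Ω] [MeasurableSpace T]
    [NormedAddCommGroup Y] [NormedSpace ℝ Y] [PartialOrder Y] (μ : Measure T) where
  /-- The σ-algebra of all events. -/
  events : MeasurableSpace Ω
  /-- The information partition of agent `t`, as an equivalence relation: its cells are the
  equivalence classes. -/
  info : T → Setoid Ω
  /-- The state-dependent utility; only its values at bundles `x ∈ Y₊` are ever used. -/
  utility : T → Ω → Y → ℝ
  /-- The random initial endowment. -/
  endow : T → Ω → Y
  /-- The prior, as a probability vector on `Ω`. -/
  prior : T → Ω → ℝ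
  endow_nonneg : ∀ t ω, 0 ≤ endow t ω
  endow_const : ∀ t ω ω', (info t) ω ω' → endow t ω = endow t ω'
  endow_integrable : ∀ ω, Integrable (fun t => endow t ω) μ
  prior_mem : ∀ t, prior t ∈ stdSimplex ℝ Ω
  prior_pos : ∀ t ω, 0 < prior t ω

namespace AsymEconomy

variable {Ω T Y : Type*} [Fintype Ω] [MeasurableSpace T]
  [NormedAddCommGroup Y] [NormedSpace ℝ Y] [PartialOrder Y] {μ : Measure T}

/-- The private information `ℱ_t`: the σ-algebra generated by the cells of the partition. -/
@[reducible] def infoAlg (E : AsymEconomy Ω T Y μ) (t : T) : MeasurableSpace Ω :=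
  MeasurableSpace.generateFrom (E.info t).classes

/-- The agents whose information partition is `Q`. -/
def agentsWith (E : AsymEconomy Ω T Y μ) (Q : Setoid Ω) : Set T :=
  {t | E.info t = Q}

/-- The ex ante expected utility `V_t(x) = ∑_ω U_t(ω, x(ω)) q_t(ω)`. -/
def expUtility (E : AsymEconomy Ω T Y μ) (t : T) (x : Ω → Y) : ℝ :=
  ∑ ω, E.utility t ω (x ω) * E.prior t ω

/-- The set `L_t` of `ℱ_t`-measurable random bundles with values in `Y₊`. -/
def privateBundles (E : AsymEconomy Ω T Y μ) (t : T) : Set (Ω → Y) :=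
  {x | (∀ ω, 0 ≤ x ω) ∧ Measurable[E.infoAlg t, borel Y] x}

/-- A coalition is a measurable set of agents of positive measure. -/
def IsCoalition (_E : AsymEconomy Ω T Y μ) (S : Set T) : Prop :=
  MeasurableSet S ∧ 0 < μ S

/-- An `S`-assignment: a `Y₊`-valued function on `S × Ω`, Bochner integrable over `S` in every
state. The values of `f` outside `S` are irrelevant. -/
def IsAssignment (_E : AsymEconomy Ω T Y μ) (S : Set T) (f : T → Ω → Y) : Prop :=
  (∀ t ∈ S, ∀ ω, 0 ≤ f t ω) ∧ ∀ ω, IntegrableOn (fun t => f t ω) S μ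

/-- An `S`-allocation: an `S`-assignment with `f(t, ·) ∈ L_t` for almost all `t ∈ S`. -/
def IsAllocation (E : AsymEconomy Ω T Y μ) (S : Set T) (f : T → Ω → Y) : Prop :=
  E.IsAssignment S f ∧ ∀ᵐ t ∂μ, t ∈ S → f t ∈ E.privateBundles t

/-- `S`-exact feasibility: `∫_S f(·, ω) dμ = ∫_S a(·, ω) dμ` in every state `ω`. -/
def IsExactlyFeasible (E : AsymEconomy Ω T Y μ) (S : Set T) (f : T → Ω → Y) : Prop :=
  ∀ ω, ∫ t in S, f t ω ∂μ = ∫ t in S, E.endow t ω ∂μ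

/-- The coalition `S` NY-privately blocks `f`. -/
def NYPrivatelyBlocks (E : AsymEconomy Ω T Y μ) (S : Set T) (f : T → Ω → Y) : Prop :=
  E.IsCoalition S ∧ ∃ g : T → Ω → Y, E.IsAllocation S g ∧ E.IsExactlyFeasible S g ∧
    ∀ᵐ t ∂μ, t ∈ S → E.expUtility t (f t) < E.expUtility t (g t)

/-- The NY-private core. -/
def NYPrivateCore (E : AsymEconomy Ω T Y μ) : Set (T → Ω → Y) :=
  {f | E.IsAllocation Set.univ f ∧ E.IsExactlyFeasible Set.univ f ∧
    ∀ S, ¬ E.NYPrivatelyBlocks S f}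

/-- (A₁) Priors and private information depend measurably on the agent. -/
def MeasurableCharacteristics (E : AsymEconomy Ω T Y μ) : Prop :=
  Measurable E.prior ∧ ∀ Q : Setoid Ω, MeasurableSet (E.agentsWith Q)

/-- (A₂) Utilities are Carathéodory functions on `T × Y₊`. -/
def CaratheodoryUtilities (E : AsymEconomy Ω T Y μ) : Prop :=
  (∀ ω, ∀ x : Y, 0 ≤ x → Measurable fun t => E.utility t ω x) ∧
    ∀ t ω, ContinuousOn (E.utility t ω) (Set.Ici 0)

/-- (A₃) Utilities are monotone. -/
def MonotoneUtilities (E : AsymEconomy Ω T Y μ) : Prop :=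
  ∀ t ω, ∀ x y : Y, 0 ≤ x → StronglyPos y → E.utility t ω x < E.utility t ω (x + y)

/-- (A₄′) Utilities are concave on `Y₊`. -/
def ConcaveUtilities (E : AsymEconomy Ω T Y μ) : Prop :=
  ∀ t ω, ConcaveOn ℝ (Set.Ici 0) (E.utility t ω)

/-- (A₅) Endowments are strictly positive. -/
def StrictlyPositiveEndowments (E : AsymEconomy Ω T Y μ) : Prop :=
  ∀ t ω, StronglyPos (E.endow t ω)

end AsymEconomy

/-! The argument is Vind's: a blocking coalition is first shrunk, then enlarged to the required
size, by selecting a fixed proportion of agents. With infinitely many commodities the integral of a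
net trade over an atomless space has only an approximately convex range, so a selected proportion
`α` carries `α` times the aggregate net trade up to a small error. An interior point of the cone
absorbs the error, provided that its correction respects private information. There are finitely
many partitions, so the selection is made among agents sharing one, and the error per head is then
constant on their cells (`exists_subset_weighted_correction`).

Shrinking (`NYPrivatelyBlocks.exists_stronglyBlocks`): moving each improving bundle slightly towards
a diminished endowment keeps it preferred by continuity and saves a multiple of an interior point
`u`. Part of the saving pays for the error; the rest is a surplus, the same in every state.

Enlarging (`StronglyBlocks.exists_blocks`): members of the small coalition receive a convex
combination of their improving bundle and `f`, preferred by concavity. A proportion of the outsiders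
receive `f` plus a strictly positive extra financed by the surplus. Exact feasibility of `f`
balances the rest. -/

/-! ### Proportional selection in atomless measure spaces. -/

/-- Integrals over a union of subsets `B i` of the fibres of `p`, computed fibrewise. -/
theorem MeasureTheory.integral_iUnion_eq_setIntegral_smul {T : Type*} [MeasurableSpace T]
    {μ : Measure T} {A : Set T}
    (hA : MeasurableSet A) {ι : Type*} [Countable ι] [MeasurableSpace ι]
    [DiscreteMeasurableSpace ι] {p : T → ι} (hp : Measurable p) {α : ι → ℝ} (hα : ∀ i, 0 < α i)
    (hα1 : ∀ i, α i ≤ 1) {B : ι → Set T} (hB : ∀ i, MeasurableSet (B i))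
    (hBA : ∀ i, B i ⊆ A ∩ p ⁻¹' {i}) {W : Type*} [NormedAddCommGroup W] [NormedSpace ℝ W]
    {F G : T → W} (hF : IntegrableOn F (⋃ i, B i) μ) (hG : IntegrableOn G A μ)
    (hFG : ∀ i, ∫ t in B i, F t ∂μ = α i • ∫ t in A ∩ p ⁻¹' {i}, G t ∂μ) :
    ∫ t in ⋃ i, B i, F t ∂μ = ∫ t in A, α (p t) • G t ∂μ := by
  have hfm : ∀ i, MeasurableSet (A ∩ p ⁻¹' {i}) := fun i =>
    hA.inter (hp (MeasurableSet.of_discrete))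
  have hAU : A = ⋃ i, A ∩ p ⁻¹' {i} := by
    ext t
    simp
  have hdisj : Pairwise (Function.onFun Disjoint fun i => A ∩ p ⁻¹' {i}) := by
    intro i j hij
    refine Set.disjoint_left.2 fun t ht ht' => hij ?_
    exact ht.2.symm.trans ht'.2
  have hdisjB : Pairwise (Function.onFun Disjoint B) := fun i j hij =>
    (hdisj hij).mono (hBA i) (hBA j)
  have hG' : IntegrableOn (fun t => α (p t) • G t) A μ :=
    hG.bdd_smul 1 (Measurable.of_discrete.comp hp).aestronglyMeasurable
      (Filter.Eventually.of_forall fun t => by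
        rw [Real.norm_of_nonneg (hα _).le]
        exact hα1 _)
  conv_rhs => rw [hAU]
  rw [integral_iUnion hB hdisjB hF, integral_iUnion hfm hdisj (by rwa [← hAU])]
  refine tsum_congr fun i => ?_
  rw [hFG, ← integral_smul]
  refine setIntegral_congr_fun (hfm i) fun t ht => ?_
  have hpt : p t = i := ht.2
  simp [hpt]

namespace MeasureTheory.Measure.Atomless

variable {T : Type*} [MeasurableSpace T] {μ : Measure T} [IsFiniteMeasure μ]

/-- In an atomless finite measure space, sets of positive measure contain subsets of arbitrarily
small positive measure. -/
theorem exists_subset_small (hμ : μ.Atomless) {A : Set T} (hA : MeasurableSet A)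
    (hA0 : 0 < μ.real A) {c : ℝ} (hc : 0 < c) :
    ∃ B ⊆ A, MeasurableSet B ∧ 0 < μ.real B ∧ μ.real B ≤ c := by
  have half : ∀ B : Set T, MeasurableSet B → 0 < μ.real B →
      ∃ C ⊆ B, MeasurableSet C ∧ 0 < μ.real C ∧ μ.real C ≤ μ.real B / 2 := by
    intro B hB hB0
    obtain ⟨C, hCB, hC, hC0, hClt⟩ := hμ B hB (by
      simpa [measureReal_def, ENNReal.toReal_pos_iff] using hB0)
    have hC0' : 0 < μ.real C := ENNReal.toReal_pos hC0.ne' (measure_ne_top _ _)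
    have hlt : μ.real C < μ.real B :=
      (ENNReal.toReal_lt_toReal (measure_ne_top _ _) (measure_ne_top _ _)).2 hClt
    have hd : μ.real (B \ C) = μ.real B - μ.real C := measureReal_sdiff hCB hC
    by_cases h : μ.real C ≤ μ.real B / 2
    · exact ⟨C, hCB, hC, hC0', h⟩
    · exact ⟨B \ C, Set.sdiff_subset, hB.diff hC, by linarith, by linarith⟩
  have iter : ∀ n : ℕ, ∃ B ⊆ A, MeasurableSet B ∧ 0 < μ.real B ∧
      μ.real B ≤ μ.real A * (1 / 2) ^ n := by
    intro n
    induction n with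
    | zero => exact ⟨A, subset_rfl, hA, hA0, by simp⟩
    | succ n ih =>
      obtain ⟨B, hBA, hB, hB0, hBn⟩ := ih
      obtain ⟨C, hCB, hC, hC0, hCn⟩ := half B hB hB0
      exact ⟨C, hCB.trans hBA, hC, hC0, by rw [pow_succ]; linarith⟩
  obtain ⟨n, hn⟩ := exists_pow_lt_of_lt_one (div_pos hc hA0) (by norm_num : (1 / 2 : ℝ) < 1)
  obtain ⟨B, hBA, hB, hB0, hBn⟩ := iter n
  refine ⟨B, hBA, hB, hB0, hBn.trans ?_⟩
  rw [lt_div_iff₀ hA0] at hn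
  linarith

/-- Sierpiński: an atomless finite measure takes all intermediate values. -/
theorem exists_subset_measureReal_eq (hμ : μ.Atomless) {A : Set T} (hA : MeasurableSet A)
    {c : ℝ} (hc : 0 ≤ c) (hcA : c ≤ μ.real A) :
    ∃ B ⊆ A, MeasurableSet B ∧ μ.real B = c := by
  let P : Set T → Prop := fun B => B ⊆ A ∧ MeasurableSet B ∧ μ.real B ≤ c
  let V : Set T → Set ℝ := fun B =>
    {x | ∃ C ⊆ A \ B, MeasurableSet C ∧ μ.real B + μ.real C ≤ c ∧ μ.real C = x}
  have Vbdd : ∀ B, BddAbove (V B) := fun B =>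
    ⟨c, by
      rintro x ⟨C, -, -, h, rfl⟩
      linarith [measureReal_nonneg (μ := μ) (s := B)]⟩
  -- Greedy exhaustion: each step adds at least half of the largest measure that still fits under
  -- `c`.
  have step : ∀ B : {B // P B}, ∃ B' : {B // P B}, B.1 ⊆ B'.1 ∧
      ∀ x ∈ V B.1, μ.real B.1 + x / 2 ≤ μ.real B'.1 := by
    rintro ⟨B, hBA, hB, hBc⟩
    have hne : (V B).Nonempty := ⟨0, ∅, Set.empty_subset _, .empty, by simpa, by simp⟩
    have hs0 : 0 ≤ sSup (V B) := le_csSup (Vbdd B)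
      ⟨∅, Set.empty_subset _, .empty, by simpa, by simp⟩
    obtain ⟨C, hCA, hC, hCc, hCs⟩ : ∃ C ⊆ A \ B, MeasurableSet C ∧ μ.real B + μ.real C ≤ c ∧
        sSup (V B) / 2 ≤ μ.real C := by
      rcases hs0.eq_or_lt with h | h
      · exact ⟨∅, Set.empty_subset _, .empty, by simpa, by simp [← h]⟩
      · obtain ⟨_, ⟨C, h1, h2, h3, rfl⟩, hx⟩ := exists_lt_of_lt_csSup hne (half_lt_self h)
        exact ⟨C, h1, h2, h3, hx.le⟩
    have hdisj : Disjoint B C := (Set.disjoint_sdiff_right).mono_right hCA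
    have hu : μ.real (B ∪ C) = μ.real B + μ.real C := measureReal_union hdisj hC
    refine ⟨⟨B ∪ C, Set.union_subset hBA (hCA.trans Set.sdiff_subset), hB.union hC, by
      rw [hu]; exact hCc⟩, Set.subset_union_left, fun x hx => ?_⟩
    have := le_csSup (Vbdd B) hx
    change _ ≤ μ.real (B ∪ C)
    rw [hu]
    linarith
  choose next hsub hnext using step
  let b : ℕ → {B // P B} := fun n =>
    next^[n] ⟨∅, Set.empty_subset _, .empty, by simpa⟩
  have bsucc : ∀ n, b (n + 1) = next (b n) := fun n => Function.iterate_succ_apply' _ _ _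
  have bmono : Monotone fun n => (b n).1 :=
    monotone_nat_of_le_succ fun n => by
      change (b n).1 ⊆ (b (n + 1)).1
      rw [bsucc]
      exact hsub _
  let B := ⋃ n, (b n).1
  have hBA : B ⊆ A := Set.iUnion_subset fun n => (b n).2.1
  have hB : MeasurableSet B := MeasurableSet.iUnion fun n => (b n).2.2.1
  have hlim : Filter.Tendsto (fun n => μ.real (b n).1) Filter.atTop (nhds (μ.real B)) :=
    (ENNReal.tendsto_toReal (measure_ne_top _ _)).comp (tendsto_measure_iUnion_atTop bmono)
  have hBc : μ.real B ≤ c := le_of_tendsto' hlim fun n => (b n).2.2.2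
  refine ⟨B, hBA, hB, hBc.antisymm ?_⟩
  by_contra! hlt
  have hdiff : μ.real (A \ B) = μ.real A - μ.real B := measureReal_sdiff hBA hB
  obtain ⟨D, hDA, hD, hD0, hDc⟩ := hμ.exists_subset_small (hA.diff hB)
    (by linarith : 0 < μ.real (A \ B)) (sub_pos.2 hlt)
  -- A piece `D` that fits beside the limit set was available at every stage, so every step gained
  -- at least half its measure, which contradicts convergence.
  have hgrow : ∀ n, μ.real (b n).1 + μ.real D / 2 ≤ μ.real (b (n + 1)).1 := by
    intro n
    rw [bsucc]
    have hle : μ.real (b n).1 ≤ μ.real B := 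
      measureReal_mono (Set.subset_iUnion (fun n => (b n).1) n)
    exact hnext (b n) _ ⟨D, hDA.trans (Set.sdiff_subset_sdiff_right 
      (Set.subset_iUnion (fun n => (b n).1) n)), hD,
      by linarith, rfl⟩
  have := le_of_tendsto_of_tendsto' (hlim.add_const (μ.real D / 2))
    (hlim.comp (Filter.tendsto_add_atTop_nat 1)) hgrow
  linarith

/-- A fixed proportion of a measurable set, taken evenly over the fibres of a simple function. -/
theorem exists_subset_simpleFunc (hμ : μ.Atomless) {A : Set T} (hA : MeasurableSet A)
    {α : ℝ} (hα : 0 ≤ α) (hα1 : α ≤ 1) {Z : Type*} [NormedAddCommGroup Z] [NormedSpace ℝ Z]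
    [CompleteSpace Z] (s : SimpleFunc T Z) :
    ∃ B ⊆ A, MeasurableSet B ∧ μ.real B = α * μ.real A ∧
      ∫ t in B, s t ∂μ = α • ∫ t in A, s t ∂μ := by
  have hfib : ∀ z, MeasurableSet (A ∩ s ⁻¹' {z}) := fun z => hA.inter (s.measurableSet_fiber z)
  have hex : ∀ z, ∃ B ⊆ A ∩ s ⁻¹' {z}, MeasurableSet B ∧
      μ.real B = α * μ.real (A ∩ s ⁻¹' {z}) := fun z =>
    hμ.exists_subset_measureReal_eq (hfib z) (by positivity)
      (mul_le_of_le_one_left measureReal_nonneg hα1)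
  choose B hBA hB hBμ using hex
  have hval : ∀ z, ∀ C ⊆ A ∩ s ⁻¹' {z}, MeasurableSet C → ∫ t in C, s t ∂μ = μ.real C • z := by
    intro z C hC hCm
    rw [setIntegral_congr_fun hCm (g := fun _ => z) fun t ht => (hC ht).2, setIntegral_const]
  have hint : ∀ z, ∀ C ⊆ A ∩ s ⁻¹' {z}, MeasurableSet C → IntegrableOn s C μ := by
    intro z C hC hCm
    exact IntegrableOn.congr_fun (f := fun _ => z) (integrable_const _)
      (fun t ht => (hC ht).2.symm) hCm
  have hAU : ⋃ z ∈ s.range, A ∩ s ⁻¹' {z} = A := by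
    ext t
    simp
  have hdisj : Set.PairwiseDisjoint (s.range : Set Z) fun z => A ∩ s ⁻¹' {z} := by
    intro z _ z' _ hzz
    refine Set.disjoint_left.2 fun t ht ht' => hzz ?_
    exact ht.2.symm.trans ht'.2
  have hdisjB : Set.PairwiseDisjoint (s.range : Set Z) B := fun z hz z' hz' h =>
    (hdisj hz hz' h).mono (hBA z) (hBA z')
  refine ⟨⋃ z ∈ s.range, B z, Set.iUnion₂_subset fun z _ => (hBA z).trans Set.inter_subset_left,
    Finset.measurableSet_biUnion _ fun z _ => hB z, ?_, ?_⟩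
  · conv_rhs => rw [← hAU]
    rw [measureReal_biUnion_finset hdisjB fun z _ => hB z,
      measureReal_biUnion_finset hdisj fun z _ => hfib z, Finset.mul_sum]
    exact Finset.sum_congr rfl fun z _ => hBμ z
  · conv_rhs => rw [← hAU]
    rw [integral_biUnion_finset _ (fun z _ => hB z) hdisjB fun z _ => hint z _ (hBA z) (hB z),
      integral_biUnion_finset _ (fun z _ => hfib z) hdisj
        (fun z _ => hint z _ subset_rfl (hfib z)), Finset.smul_sum]
    refine Finset.sum_congr rfl fun z _ => ?_
    rw [hval z _ (hBA z) (hB z), hval z _ subset_rfl (hfib z), hBμ, mul_smul]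

/-- Approximate convexity of the range of a Banach-space-valued integral. -/
theorem exists_subset_norm_integral_sub_lt (hμ : μ.Atomless) {A : Set T} (hA : MeasurableSet A)
    {α : ℝ} (hα : 0 ≤ α) (hα1 : α ≤ 1) {Z : Type*} [NormedAddCommGroup Z] [NormedSpace ℝ Z]
    [CompleteSpace Z] {h : T → Z} (hh : IntegrableOn h A μ) {η : ℝ} (hη : 0 < η) :
    ∃ B ⊆ A, MeasurableSet B ∧ μ.real B = α * μ.real A ∧
      ‖∫ t in B, h t ∂μ - α • ∫ t in A, h t ∂μ‖ < η := by
  obtain ⟨s, hs, hsi⟩ := (memLp_one_iff_integrable.2 hh).exists_simpleFunc_eLpNorm_sub_lt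
    ENNReal.one_ne_top (ε := ENNReal.ofReal (η / 3)) (by simpa using hη)
  have hsi' : IntegrableOn s A μ := memLp_one_iff_integrable.1 hsi
  have hd : IntegrableOn (fun t => h t - s t) A μ := hh.sub hsi'
  have hsmall : ∫ t in A, ‖h t - s t‖ ∂μ < η / 3 := by
    rw [integral_norm_eq_lintegral_enorm hd.aestronglyMeasurable]
    rw [eLpNorm_one_eq_lintegral_enorm] at hs
    exact (ENNReal.toReal_lt_of_lt_ofReal hs)
  obtain ⟨B, hBA, hB, hBμ, hBs⟩ := hμ.exists_subset_simpleFunc hA hα hα1 s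
  refine ⟨B, hBA, hB, hBμ, ?_⟩
  -- The selection is exact for `s`, so the whole error comes from `h - s` and is at most twice its
  -- `L¹` norm.
  have e : ∫ t in B, h t ∂μ - α • ∫ t in A, h t ∂μ
      = ∫ t in B, (h t - s t) ∂μ - α • ∫ t in A, (h t - s t) ∂μ := by
    rw [integral_sub hh hsi', integral_sub (hh.mono_set hBA) (hsi'.mono_set hBA), hBs, smul_sub]
    abel
  have h1 : ‖∫ t in B, (h t - s t) ∂μ‖ ≤ ∫ t in A, ‖h t - s t‖ ∂μ :=
    (norm_integral_le_integral_norm _).trans (setIntegral_mono_set hd.norm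
      (Filter.Eventually.of_forall fun _ => norm_nonneg _) hBA.eventuallyLE)
  have h2 : ‖α • ∫ t in A, (h t - s t) ∂μ‖ ≤ ∫ t in A, ‖h t - s t‖ ∂μ := by
    rw [norm_smul, Real.norm_of_nonneg hα]
    exact (mul_le_of_le_one_left (norm_nonneg _) hα1).trans (norm_integral_le_integral_norm _)
  rw [e]
  exact (norm_sub_le _ _).trans_lt (by linarith)

/-- A proportion `α` of `A` whose aggregate of `h` is `α` times that of `A`, up to a small
correction per head that is constant on the classes on which `h` is. -/
theorem exists_subset_correction (hμ : μ.Atomless) {A : Set T} (hA : MeasurableSet A)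
    {α : ℝ} (hα : 0 < α) (hα1 : α ≤ 1) {Ω Y : Type*} [Fintype Ω] [NormedAddCommGroup Y]
    [NormedSpace ℝ Y] [CompleteSpace Y] {h : T → Ω → Y}
    (hh : ∀ ω, IntegrableOn (fun t => h t ω) A μ)
    {Q : Setoid Ω} (hQ : ∀ᵐ t ∂μ, t ∈ A → ∀ ω ω', Q ω ω' → h t ω = h t ω')
    {η : ℝ} (hη : 0 < η) :
    ∃ B ⊆ A, MeasurableSet B ∧ μ.real B = α * μ.real A ∧ ∃ e : Ω → Y,
      (∀ ω, ‖e ω‖ < η) ∧ (∀ ω ω', Q ω ω' → e ω = e ω') ∧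
      ∀ ω, ∫ t in B, (h t ω - e ω) ∂μ = α • ∫ t in A, h t ω ∂μ := by
  rcases (measureReal_nonneg (μ := μ) (s := A)).eq_or_lt with h0 | h0
  · refine ⟨∅, Set.empty_subset _, .empty, by simp [← h0], fun _ => 0, by simp [hη], by simp,
      fun ω => ?_⟩
    have : μ A = 0 := (measureReal_eq_zero_iff (measure_ne_top _ _)).1 h0.symm
    simp [Measure.restrict_eq_zero.2 this]
  -- Integrating `h` with values in `Ω → Y` gives one set `B` that serves all states at once.
  have hh' : IntegrableOn h A μ := Integrable.of_eval hh
  obtain ⟨B, hBA, hB, hBμ, hBh⟩ := hμ.exists_subset_norm_integral_sub_lt hA hα.le hα1 hh'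
    -- This tolerance is `η * μ.real B`; spread evenly over `B`, the error per head stays below `η`.
    (η := η * (α * μ.real A)) (by positivity)
  have hB0 : 0 < μ.real B := by rw [hBμ]; positivity
  have heval : ∀ C ⊆ A, ∀ ω, (∫ t in C, h t ∂μ) ω = ∫ t in C, h t ω ∂μ := fun C hC ω =>
    eval_integral (fun ω => (hh ω).mono_set hC) ω
  have hconst : ∀ C ⊆ A, MeasurableSet C → ∀ ω ω', Q ω ω' →
      ∫ t in C, h t ω ∂μ = ∫ t in C, h t ω' ∂μ := fun C hC hCm ω ω' hω =>
    setIntegral_congr_ae hCm (hQ.mono fun t ht htC => ht (hC htC) ω ω' hω)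
  refine ⟨B, hBA, hB, hBμ, fun ω => (μ.real B)⁻¹ •
    (∫ t in B, h t ω ∂μ - α • ∫ t in A, h t ω ∂μ), fun ω => ?_, fun ω ω' hω => ?_, fun ω => ?_⟩
  · rw [norm_smul, norm_inv, Real.norm_of_nonneg hB0.le, inv_mul_lt_iff₀ hB0, hBμ, mul_comm]
    refine lt_of_le_of_lt ?_ hBh
    rw [← heval B hBA, ← heval A subset_rfl]
    exact norm_le_pi_norm (∫ t in B, h t ∂μ - α • ∫ t in A, h t ∂μ) ω
  · simp only [hconst B hBA hB ω ω' hω, hconst A subset_rfl hA ω ω' hω]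
  · rw [integral_sub ((hh ω).mono_set hBA) (integrable_const _), setIntegral_const,
      smul_inv_smul₀ hB0.ne', sub_sub_cancel]

/-- Countably many applications of `exists_subset_correction`, one for each fibre of `p`. -/
theorem exists_subset_weighted_correction (hμ : μ.Atomless) {A : Set T} (hA : MeasurableSet A)
    {ι : Type*} [Countable ι] [MeasurableSpace ι] [DiscreteMeasurableSpace ι] {p : T → ι}
    (hp : Measurable p) {α : ι → ℝ} (hα : ∀ i, 0 < α i) (hα1 : ∀ i, α i ≤ 1)
    {Ω Y : Type*} [Fintype Ω] [NormedAddCommGroup Y]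
    [NormedSpace ℝ Y] [CompleteSpace Y] {h : T → Ω → Y}
    (hh : ∀ ω, IntegrableOn (fun t => h t ω) A μ) {Q : ι → Setoid Ω}
    (hQ : ∀ᵐ t ∂μ, t ∈ A → ∀ ω ω', Q (p t) ω ω' → h t ω = h t ω')
    {η : ι → ℝ} (hη : ∀ i, 0 < η i) (hη1 : ∀ i, η i ≤ 1) :
    ∃ B ⊆ A, MeasurableSet B ∧ μ.real B = ∫ t in A, α (p t) ∂μ ∧ ∃ e : ι → Ω → Y,
      (∀ i ω, ‖e i ω‖ < η i) ∧ (∀ i ω ω', Q i ω ω' → e i ω = e i ω') ∧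
      (∀ ω, Integrable (fun t => e (p t) ω) μ) ∧
      ∀ ω, ∫ t in B, (h t ω - e (p t) ω) ∂μ = ∫ t in A, α (p t) • h t ω ∂μ := by
  have hfm : ∀ i, MeasurableSet (A ∩ p ⁻¹' {i}) := fun i =>
    hA.inter (hp (MeasurableSet.of_discrete))
  have hex := fun i : ι => hμ.exists_subset_correction (hfm i) (hα i) (hα1 i)
    (fun ω => (hh ω).mono_set Set.inter_subset_left)
    (hQ.mono fun t ht (htA : t ∈ A ∩ p ⁻¹' {i}) => by
      have hpt : p t = i := htA.2
      subst hpt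
      exact ht htA.1) (Q := Q i) (hη i)
  choose B hBA hB hBμ e he heQ hint using hex
  have hBsub : (⋃ i, B i) ⊆ A := Set.iUnion_subset fun i => (hBA i).trans Set.inter_subset_left
  have hei : ∀ ω, Integrable (fun t => e (p t) ω) μ := by
    intro ω
    -- The correction may take infinitely many values; the uniform bound on `η` keeps it integrable.
    refine Integrable.of_bound (C := 1) ?_ (Filter.Eventually.of_forall fun t =>
      (he (p t) ω).le.trans (hη1 _))
    have : StronglyMeasurable fun i => e i ω := .of_discrete
    exact (this.comp_measurable hp).aestronglyMeasurable
  refine ⟨⋃ i, B i, hBsub, MeasurableSet.iUnion hB, ?_, e, he, heQ, hei, fun ω => ?_⟩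
  · have := integral_iUnion_eq_setIntegral_smul (μ := μ) hA hp hα hα1 hB hBA
      (F := fun _ => (1 : ℝ)) (G := fun _ => (1 : ℝ)) (integrable_const _) (integrable_const _)
      (fun i => by simpa using hBμ i)
    simpa using this
  · refine integral_iUnion_eq_setIntegral_smul hA hp hα hα1 hB hBA
      (F := fun t => h t ω - e (p t) ω) (G := fun t => h t ω)
      (((hh ω).mono_set hBsub).sub (hei ω).integrableOn) (hh ω) fun i => ?_
    rw [← hint i ω]
    refine setIntegral_congr_fun (hB i) fun t ht => ?_
    have hpt : p t = i := (hBA i ht).2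
    simp [hpt]

end MeasureTheory.Measure.Atomless

/-! ### Interior points of the positive cone. -/

theorem StronglyPos.nonneg {Y : Type*} [TopologicalSpace Y] [Zero Y] [Preorder Y] {x : Y} (hx : StronglyPos x) : 0 ≤ x :=
  interior_subset hx

theorem StronglyPos.add_nonneg {Y : Type*} [NormedAddCommGroup Y] [PartialOrder Y]
    [IsOrderedAddMonoid Y] {x y : Y} (hx : StronglyPos x) (hy : 0 ≤ y) :
    StronglyPos (x + y) := by
  rw [StronglyPos, mem_interior] at hx ⊢
  obtain ⟨O, hO, hOo, hxO⟩ := hx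
  refine ⟨(fun z => z - y) ⁻¹' O, fun z hz => ?_, hOo.preimage (by fun_prop), by simpa⟩
  have h : (0 : Y) ≤ z - y := hO hz
  have := _root_.add_nonneg h hy
  simpa using this

theorem StronglyPos.smul {Y : Type*} [NormedAddCommGroup Y] [NormedSpace ℝ Y] [PartialOrder Y]
    [IsOrderedModule ℝ Y] {x : Y} (hx : StronglyPos x) {c : ℝ} (hc : 0 < c) :
    StronglyPos (c • x) := by
  rw [StronglyPos, mem_interior] at hx ⊢
  obtain ⟨O, hO, hOo, hxO⟩ := hx
  refine ⟨(fun z => c⁻¹ • z) ⁻¹' O, fun z hz => ?_, hOo.preimage (by fun_prop), by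
    simpa [smul_smul, hc.ne'] using hxO⟩
  have h : (0 : Y) ≤ c⁻¹ • z := hO hz
  have := smul_nonneg hc.le h
  simpa [smul_smul, hc.ne'] using this

/-- A strongly positive vector absorbs perturbations that are small relative to its size. -/
theorem StronglyPos.exists_radius {Y : Type*} [NormedAddCommGroup Y] [NormedSpace ℝ Y]
    [PartialOrder Y] [IsOrderedModule ℝ Y] {u : Y} (hu : StronglyPos u) :
    ∃ r : ℝ, 0 < r ∧ r ≤ 1 ∧
      ∀ (c : ℝ) (e : Y), 0 < c → ‖e‖ < c * r → StronglyPos (c • u + e) := by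
  obtain ⟨r, hr, hball⟩ := Metric.isOpen_iff.1 isOpen_interior u hu
  refine ⟨min r 1, lt_min hr one_pos, min_le_right _ _, fun c e hc he => ?_⟩
  have h1 : StronglyPos (u + c⁻¹ • e) := by
    refine hball ?_
    rw [mem_ball_iff_norm, add_sub_cancel_left, norm_smul, norm_inv, Real.norm_of_nonneg hc.le,
      inv_mul_lt_iff₀ hc]
    exact he.trans_le (mul_le_mul_of_nonneg_left (min_le_left _ _) hc.le)
  have := h1.smul hc
  simpa [smul_add, smul_smul, hc.ne'] using this

/-! ### Measurability of composed utilities and finiteness of the set of partitions. -/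

/-- Superposition of a Carathéodory function on a cone and a strongly measurable function with
values in the cone. -/
theorem aemeasurable_superposition {T Y : Type*} [MeasurableSpace T] {μ : Measure T}
    [NormedAddCommGroup Y] [PartialOrder Y] {U : T → Y → ℝ}
    (hU : ∀ x, 0 ≤ x → Measurable fun t => U t x)
    (hUc : ∀ t, ContinuousOn (U t) (Set.Ici 0)) {h : T → Y} (hh : AEStronglyMeasurable h μ)
    (h0 : ∀ t, 0 ≤ h t) : AEMeasurable (fun t => U t (h t)) μ := by
  obtain ⟨N, hN, hNm, hN0⟩ := exists_measurable_superset_of_null hh.ae_eq_mk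
  have hNt : ∀ t ∉ N, h t = hh.mk h t := fun t ht => by
    by_contra h'
    exact ht (hN h')
  -- The measurable representative may leave the cone on a null set, where `U` is uncontrolled; it
  -- is replaced by `0` there. Being cone-valued, `k` then has simple approximants inside the cone.
  let k₀ : T → Y := Nᶜ.indicator (hh.mk h)
  have hk₀ : StronglyMeasurable k₀ := hh.stronglyMeasurable_mk.indicator hNm.compl
  have hk₀0 : ∀ t, k₀ t ∈ Set.Ici (0 : Y) := by
    intro t
    by_cases ht : t ∈ N
    · simp [k₀, ht]
    · simpa [k₀, ht, ← hNt t ht] using h0 t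
  let k : T → Set.Ici (0 : Y) := fun t => ⟨k₀ t, hk₀0 t⟩
  have hk : StronglyMeasurable k :=
    (Embedding.comp_stronglyMeasurable_iff Topology.IsEmbedding.subtypeVal).1 hk₀
  have hmeas : Measurable fun t => U t (k t) := by
    refine measurable_of_tendsto_metrizable (f := fun n t => U t (hk.approx n t)) (fun n => ?_)
      (tendsto_pi_nhds.2 fun t => ?_)
    · exact (hk.approx n).measurable_bind (fun x t => U t x) fun x => hU x x.2
    · exact ((hUc t).domRestrict.tendsto (k t)).comp (hk.tendsto_approx t)
  refine hmeas.aemeasurable.congr ?_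
  have hNae : ∀ᵐ t ∂μ, t ∉ N := measure_eq_zero_iff_ae_notMem.1 hN0
  filter_upwards [hNae] with t ht
  simp [k, k₀, ht, hNt t ht]

theorem finite_setoid (Ω : Type*) [Finite Ω] : Finite (Setoid Ω) :=
  Finite.of_injective (fun Q : Setoid Ω => fun ω ω' => Q ω ω')
    fun Q Q' h => Setoid.ext fun ω ω' => by simpa using congrFun (congrFun h ω) ω'

/-! ### Private bundles and expected utility. -/

namespace AsymEconomy

variable {Ω T Y : Type*} [Fintype Ω] [MeasurableSpace T]
  [NormedAddCommGroup Y] [NormedSpace ℝ Y] [PartialOrder Y] {μ : Measure T}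
  {E : AsymEconomy Ω T Y μ}

/-- Private bundles are the nonnegative bundles that are constant on the cells. -/
theorem mem_privateBundles_iff {t : T} {x : Ω → Y} :
    x ∈ E.privateBundles t ↔ (∀ ω, 0 ≤ x ω) ∧ ∀ ω ω', (E.info t) ω ω' → x ω = x ω' := by
  refine and_congr_right fun _ => ⟨fun hx ω ω' hω => ?_, fun hx s _ => ?_⟩
  -- Every set in the private σ-algebra is a union of cells, so the preimage of the point `x ω`
  -- contains the whole cell of `ω`.
  · have hle : E.infoAlg t ≤ MeasurableSpace.comap (Quotient.mk (E.info t)) ⊤ := by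
      refine MeasurableSpace.generateFrom_le ?_
      rintro _ ⟨y, rfl⟩
      exact ⟨{Quotient.mk _ y}, trivial, by
        ext z
        exact Quotient.eq⟩
    have hsing : MeasurableSet[borel Y] {x ω} := by
      borelize Y
      exact measurableSet_singleton _
    obtain ⟨s, -, hs⟩ := hle _ (hx hsing)
    have h1 : ω ∈ x ⁻¹' {x ω} := rfl
    rw [← hs] at h1
    have h2 : ω' ∈ Quotient.mk (E.info t) ⁻¹' s := by
      have : Quotient.mk (E.info t) ω' = Quotient.mk (E.info t) ω :=
        Quotient.sound ((E.info t).symm hω)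
      simpa [this] using h1
    rw [hs] at h2
    exact h2.symm
  · have : x ⁻¹' s = ⋃ ω ∈ x ⁻¹' s, {ω' | (E.info t) ω' ω} := by
      ext z
      simp only [Set.mem_preimage, Set.mem_iUnion, Set.mem_ofPred_eq, exists_prop]
      exact ⟨fun hz => ⟨z, hz, (E.info t).refl z⟩, fun ⟨y, hy, hzy⟩ => by rwa [hx z y hzy]⟩
    rw [this]
    exact MeasurableSet.biUnion (Set.to_countable _) fun ω _ =>
      MeasurableSpace.measurableSet_generateFrom ⟨ω, rfl⟩

/-- The increment `c • u + (y - x)` is interior for `c > 0`, so strict monotonicity applies to it;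
continuity then lets `c` tend to `0`. -/
theorem MonotoneUtilities.utility_le [IsOrderedAddMonoid Y] [IsOrderedModule ℝ Y]
    (hA3 : E.MonotoneUtilities) (hA2 : E.CaratheodoryUtilities)
    (hY : (interior (Set.Ici (0 : Y))).Nonempty) (t : T) (ω : Ω) {x y : Y} (hx : 0 ≤ x)
    (hxy : x ≤ y) : E.utility t ω x ≤ E.utility t ω y := by
  obtain ⟨u, hu⟩ := hY
  have hu : StronglyPos u := hu
  have hy : 0 ≤ y := hx.trans hxy
  have hlim : Filter.Tendsto (fun c : ℝ => y + c • u) (nhdsWithin 0 (Set.Ioi 0))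
      (nhdsWithin y (Set.Ici 0)) := by
    refine tendsto_nhdsWithin_iff.2 ⟨?_, ?_⟩
    · have : Filter.Tendsto (fun c : ℝ => y + c • u) (nhds 0) (nhds (y + (0 : ℝ) • u)) :=
        Continuous.tendsto (by fun_prop) 0
      simpa using this.mono_left nhdsWithin_le_nhds
    · filter_upwards [self_mem_nhdsWithin] with c hc
      exact add_nonneg hy (hu.smul hc).nonneg
  refine ge_of_tendsto ((hA2.2 t ω y hy).tendsto.comp hlim) ?_
  filter_upwards [self_mem_nhdsWithin] with c hc
  have h := hA3 t ω x (c • u + (y - x)) hx ((hu.smul hc).add_nonneg (sub_nonneg.2 hxy))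
  have e : x + (c • u + (y - x)) = y + c • u := by abel
  rw [e] at h
  exact h.le

theorem expUtility_mono {t : T} {x y : Ω → Y}
    (h : ∀ ω, E.utility t ω (x ω) ≤ E.utility t ω (y ω)) : E.expUtility t x ≤ E.expUtility t y :=
  Finset.sum_le_sum fun ω _ => mul_le_mul_of_nonneg_right (h ω) (E.prior_pos t ω).le

theorem expUtility_strictMono [Nonempty Ω] {t : T} {x y : Ω → Y}
    (h : ∀ ω, E.utility t ω (x ω) < E.utility t ω (y ω)) : E.expUtility t x < E.expUtility t y :=
  Finset.sum_lt_sum_of_nonempty Finset.univ_nonempty fun ω _ =>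
    mul_lt_mul_of_pos_right (h ω) (E.prior_pos t ω)

theorem ConcaveUtilities.expUtility_le (hA4 : E.ConcaveUtilities) (t : T) {x y : Ω → Y}
    (hx : ∀ ω, 0 ≤ x ω) (hy : ∀ ω, 0 ≤ y ω) {α : ℝ} (hα : 0 ≤ α) (hα1 : α ≤ 1) :
    (1 - α) * E.expUtility t x + α * E.expUtility t y ≤
      E.expUtility t fun ω => (1 - α) • x ω + α • y ω := by
  simp only [expUtility, Finset.mul_sum, ← Finset.sum_add_distrib]
  refine Finset.sum_le_sum fun ω _ => ?_
  have := (hA4 t ω).2 (hx ω) (hy ω) (sub_nonneg.2 hα1) hα (by ring)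
  simp only [smul_eq_mul] at this
  have := mul_le_mul_of_nonneg_right this (E.prior_pos t ω).le
  linarith

theorem aemeasurable_expUtility (hA1 : E.MeasurableCharacteristics)
    (hA2 : E.CaratheodoryUtilities) {h : T → Ω → Y}
    (hh : ∀ ω, AEStronglyMeasurable (fun t => h t ω) μ) (h0 : ∀ t ω, 0 ≤ h t ω) :
    AEMeasurable (fun t => E.expUtility t (h t)) μ := by
  refine Finset.aemeasurable_fun_sum _ fun ω _ => AEMeasurable.mul ?_ ?_
  · exact aemeasurable_superposition (U := fun t => E.utility t ω) (hA2.1 ω)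
      (fun t => hA2.2 t ω) (hh ω) fun t => h0 t ω
  · exact ((measurable_pi_apply ω).comp hA1.1).aemeasurable

theorem measurable_info (hA1 : E.MeasurableCharacteristics) :
    Measurable[_, ⊤] E.info := by
  let _ : MeasurableSpace (Setoid Ω) := ⊤
  have := finite_setoid Ω
  exact measurable_to_countable' fun Q => hA1.2 Q

end AsymEconomy

theorem MeasureTheory.setIntegral_pos_of_pos {T : Type*} [MeasurableSpace T] {μ : Measure T}
    {A : Set T} (hA : 0 < μ A) {φ : T → ℝ} (hφ : IntegrableOn φ A μ) (hpos : ∀ t, 0 < φ t) :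
    0 < ∫ t in A, φ t ∂μ := by
  rw [integral_pos_iff_support_of_nonneg (fun t => (hpos t).le) hφ]
  have : Function.support φ = Set.univ := Set.eq_univ_of_forall fun t => (hpos t).ne'
  simpa [this] using hA

/-! ### Shrinking to a small coalition with a surplus. -/

namespace AsymEconomy

variable {Ω T Y : Type*} [Fintype Ω] [MeasurableSpace T]
  [NormedAddCommGroup Y] [NormedSpace ℝ Y] [PartialOrder Y] {μ : Measure T}
  {E : AsymEconomy Ω T Y μ}

/-- `S` can improve upon `f` while saving the same strongly positive bundle in every state. -/
def StronglyBlocks (E : AsymEconomy Ω T Y μ) (S : Set T) (f : T → Ω → Y) : Prop :=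
  E.IsCoalition S ∧ ∃ g : T → Ω → Y, E.IsAllocation S g ∧
    (∃ u : Y, StronglyPos u ∧ ∀ ω, ∫ t in S, (E.endow t ω - g t ω) ∂μ = u) ∧
    ∀ᵐ t ∂μ, t ∈ S → E.expUtility t (f t) < E.expUtility t (g t)

/-- The bundle of an agent who moves a fraction `c` of the way from `x` towards `a - c • u`. -/
def contraction (c : ℝ) (u : Y) (x a : Ω → Y) (ω : Ω) : Y :=
  (1 - c) • x ω + c • (a ω - c • u)

/-- As the fraction tends to `0`, the contraction tends to `x` inside the cone, where utility is
continuous. The admissible `k` depends on the agent. -/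
theorem exists_lt_expUtility_contraction [IsOrderedAddMonoid Y] [IsOrderedModule ℝ Y]
    (hA2 : E.CaratheodoryUtilities) (hA5 : E.StrictlyPositiveEndowments) (u : Y) {t : T}
    {x : Ω → Y} (hx : ∀ ω, 0 ≤ x ω) {v : ℝ} (hv : v < E.expUtility t x) {l : ℕ → ℝ}
    (hl0 : ∀ k, 0 < l k) (hl1 : ∀ k, l k ≤ 1) (hl : Filter.Tendsto l Filter.atTop (nhds 0)) :
    ∃ k, (∀ ω, StronglyPos (E.endow t ω - l k • u)) ∧
      v < E.expUtility t (contraction (l k) u x (E.endow t)) := by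
  have h1 : ∀ᶠ k in Filter.atTop, ∀ ω, StronglyPos (E.endow t ω - l k • u) := by
    refine Filter.eventually_all.2 fun ω => ?_
    have : Filter.Tendsto (fun c : ℝ => E.endow t ω - c • u) (nhds 0)
        (nhds (E.endow t ω - (0 : ℝ) • u)) := Continuous.tendsto (by fun_prop) 0
    rw [zero_smul, sub_zero] at this
    exact (this.comp hl).eventually (isOpen_interior.mem_nhds (hA5 t ω))
  have h2 : Filter.Tendsto (fun k => E.expUtility t (contraction (l k) u x (E.endow t)))
      Filter.atTop (nhds (E.expUtility t x)) := by
    refine tendsto_finsetSum _ fun ω _ => Filter.Tendsto.mul_const _ ?_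
    refine (hA2.2 t ω (x ω) (hx ω)).tendsto.comp (tendsto_nhdsWithin_iff.2 ⟨?_, ?_⟩)
    · have : Filter.Tendsto (fun c : ℝ => contraction c u x (E.endow t) ω) (nhds 0)
          (nhds (contraction 0 u x (E.endow t) ω)) :=
        Continuous.tendsto (by unfold contraction; fun_prop) 0
      rw [contraction, sub_zero, one_smul, zero_smul, add_zero] at this
      exact this.comp hl
    · filter_upwards [h1] with k hk
      exact add_nonneg (smul_nonneg (sub_nonneg.2 (hl1 k)) (hx ω))
        (smul_nonneg (hl0 k).le (hk ω).nonneg)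
  exact (h1.and (h2.eventually (lt_mem_nhds hv))).exists

theorem measurableSet_lt_expUtility_contraction [IsOrderedAddMonoid Y] [IsOrderedModule ℝ Y]
    [μ.IsComplete]
    (hA1 : E.MeasurableCharacteristics) (hA2 : E.CaratheodoryUtilities) (u : Y)
    {f g : T → Ω → Y} (hf : E.IsAllocation Set.univ f) {S : Set T} (hS : MeasurableSet S)
    (hg : E.IsAllocation S g) {c : ℝ} (hc : 0 < c) (hc1 : c ≤ 1) :
    MeasurableSet {t | t ∈ S ∧ (∀ ω, StronglyPos (E.endow t ω - c • u)) ∧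
      E.expUtility t (f t) < E.expUtility t (contraction c u (g t) (E.endow t))} := by
  have ha : ∀ ω, AEStronglyMeasurable (fun t => E.endow t ω) μ := fun ω =>
    (E.endow_integrable ω).aestronglyMeasurable
  have hD : MeasurableSet (S ∩ {t | ∀ ω, StronglyPos (E.endow t ω - c • u)}) := by
    refine hS.inter ?_
    rw [Set.ofPred_forall]
    refine MeasurableSet.iInter fun ω => NullMeasurableSet.measurable_of_complete (μ := μ) ?_
    borelize Y
    exact ((ha ω).sub aestronglyMeasurable_const).aemeasurable.nullMeasurable
      isOpen_interior.measurableSet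
  set D := S ∩ {t | ∀ ω, StronglyPos (E.endow t ω - c • u)} with hDdef
  -- Off `D` the contraction may leave the cone; setting it to `0` there allows composition with the
  -- utilities.
  let h : T → Ω → Y := fun t ω => D.indicator (fun t => contraction c u (g t) (E.endow t) ω) t
  have hhm : ∀ ω, AEStronglyMeasurable (fun t => h t ω) μ := fun ω => by
    refine (aestronglyMeasurable_indicator_iff hD).2 ?_
    have h1 := ((hg.1.2 ω).mono_set (Set.inter_subset_left : D ⊆ S)).aestronglyMeasurable
    exact (h1.const_smul (1 - c)).add
      (((ha ω).restrict.sub aestronglyMeasurable_const).const_smul c)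
  have hh0 : ∀ t ω, 0 ≤ h t ω := fun t ω => by
    refine Set.indicator_nonneg (fun t ht => ?_) t
    exact add_nonneg (smul_nonneg (sub_nonneg.2 hc1) (hg.1.1 t ht.1 ω))
      (smul_nonneg hc.le (ht.2 ω).nonneg)
  have hVf : AEMeasurable (fun t => E.expUtility t (f t)) μ :=
    aemeasurable_expUtility hA1 hA2
      (fun ω => (integrableOn_univ.1 (hf.1.2 ω)).aestronglyMeasurable)
      fun t ω => hf.1.1 t trivial ω
  have hVh := aemeasurable_expUtility hA1 hA2 hhm hh0
  have hlt := NullMeasurableSet.measurable_of_complete (nullMeasurableSet_lt hVf hVh)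
  convert hD.inter hlt using 1
  ext t
  simp only [Set.mem_ofPred_eq, Set.mem_inter_iff, hDdef, and_assoc]
  refine and_congr_right fun htS => and_congr_right fun htD => ?_
  have : h t = contraction c u (g t) (E.endow t) := funext fun ω =>
    Set.indicator_of_mem (show t ∈ D from ⟨htS, htD⟩) _
  rw [this]

/-- A blocking coalition contains arbitrarily small strongly blocking coalitions. -/
theorem NYPrivatelyBlocks.exists_stronglyBlocks [CompleteSpace Y] [IsOrderedAddMonoid Y]
    [IsOrderedModule ℝ Y] [IsFiniteMeasure μ] [μ.IsComplete]
    (hY : (interior (Set.Ici (0 : Y))).Nonempty) (hμ : μ.Atomless)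
    (hA1 : E.MeasurableCharacteristics) (hA2 : E.CaratheodoryUtilities)
    (hA3 : E.MonotoneUtilities) (hA5 : E.StrictlyPositiveEndowments)
    {f : T → Ω → Y} (hf : E.IsAllocation Set.univ f) {S : Set T} (hS : E.NYPrivatelyBlocks S f)
    {ε : ℝ} (hε : 0 < ε) : ∃ S', μ.real S' < ε ∧ E.StronglyBlocks S' f := by
  obtain ⟨⟨hSm, hS0⟩, g, hg, hgfeas, hgV⟩ := hS
  obtain ⟨u, hu⟩ := hY
  have hu : StronglyPos u := hu
  obtain ⟨r, hr0, hr1, hr⟩ := hu.exists_radius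
  -- The shift by `2` gives `l k ≤ 1 / 2`, so that `(1 - l k)⁻¹ ≤ 2`.
  let l : ℕ → ℝ := fun k => ((k : ℝ) + 2)⁻¹
  have hl0 : ∀ k, 0 < l k := fun k => by positivity
  have hl2 : ∀ k, l k ≤ 1 / 2 := fun k => by
    rw [one_div]
    exact inv_anti₀ two_pos (by linarith [k.cast_nonneg (α := ℝ)])
  have hl1 : ∀ k, l k ≤ 1 := fun k => (hl2 k).trans (by norm_num)
  have hl : Filter.Tendsto l Filter.atTop (nhds 0) :=
    tendsto_inv_atTop_zero.comp
      (Filter.tendsto_atTop_add_const_right _ 2 tendsto_natCast_atTop_atTop)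
  let M : ℕ → Set T := fun k => {t | t ∈ S ∧ (∀ ω, StronglyPos (E.endow t ω - l k • u)) ∧
    E.expUtility t (f t) < E.expUtility t (contraction (l k) u (g t) (E.endow t))}
  have hM : ∀ k, MeasurableSet (M k) := fun k =>
    measurableSet_lt_expUtility_contraction hA1 hA2 u hf hSm hg (hl0 k) (hl1 k)
  let A := ⋃ k, M k
  have hA : MeasurableSet A := MeasurableSet.iUnion hM
  have hAS : A ⊆ S := Set.iUnion_subset fun k t ht => ht.1
  have hAae : A =ᵐ[μ] S := by
    refine hAS.eventuallyLE.antisymm ?_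
    filter_upwards [hgV] with t ht htS
    obtain ⟨k, hk⟩ :=
      exists_lt_expUtility_contraction hA2 hA5 u (hg.1.1 t htS) (ht htS) hl0 hl1 hl
    exact Set.mem_iUnion.2 ⟨k, htS, hk⟩
  have hA0 : 0 < μ A := by rwa [measure_congr hAae]
  have hAr : 0 < μ.real A := ENNReal.toReal_pos hA0.ne' (measure_ne_top _ _)
  classical
  -- The second alternative makes the least index defined, and measurable, on all of `T`.
  have hfind : ∀ t, ∃ k, t ∈ M k ∨ t ∉ A := fun t => by
    by_cases ht : t ∈ A
    · obtain ⟨k, hk⟩ := Set.mem_iUnion.1 ht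
      exact ⟨k, .inl hk⟩
    · exact ⟨0, .inr ht⟩
  let idx : T → ℕ := fun t => Nat.find (hfind t)
  have hidx : Measurable idx := measurable_find hfind fun k => (hM k).union hA.compl
  have hidxM : ∀ t ∈ A, t ∈ M (idx t) := fun t ht =>
    (Nat.find_spec (hfind t)).resolve_right (not_not.2 ht)
  let _ : MeasurableSpace (Setoid Ω) := ⊤
  have := finite_setoid Ω
  have hinfo : Measurable E.info := measurable_info hA1
  have hlm : Measurable fun t => l (idx t) :=
    (Measurable.of_discrete (f := l)).comp hidx
  have hbdd : ∀ φ : ℝ → ℝ, Measurable φ → (∀ k, |φ (l k)| ≤ 2) →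
      Integrable (fun t => φ (l (idx t))) μ := fun φ hφ hφb =>
    Integrable.of_bound (hφ.comp hlm).aestronglyMeasurable 2
      (Filter.Eventually.of_forall fun t => hφb _)
  have hbddY : ∀ φ : ℝ → ℝ, Measurable φ → (∀ k, |φ (l k)| ≤ 2) → ∀ {ν : Measure T} {y : T → Y},
      Integrable y ν → Integrable (fun t => φ (l (idx t)) • y t) ν := fun φ hφ hφb ν y hy =>
    hy.bdd_smul 2 (hφ.comp hlm).aestronglyMeasurable
      (Filter.Eventually.of_forall fun t => hφb _)
  have hgA : ∀ ω, IntegrableOn (fun t => g t ω) A μ := fun ω => (hg.1.2 ω).mono_set hAS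
  have haA : ∀ ω, IntegrableOn (fun t => E.endow t ω) A μ := fun ω =>
    (E.endow_integrable ω).integrableOn
  -- The proportions selected below are at most `2 * α`; these bounds keep them at most `1` and the
  -- coalition smaller than `ε`.
  obtain ⟨α, hα0, hα2, hαε⟩ : ∃ α : ℝ, 0 < α ∧ α ≤ 1 / 2 ∧ 2 * α * μ.real A < ε := by
    refine ⟨min (1 / 2) (ε / (4 * μ.real A)), by positivity, min_le_left _ _, ?_⟩
    have := mul_le_mul_of_nonneg_right (min_le_right (1 / 2) (ε / (4 * μ.real A))) hAr.le
    have h4 : ε / (4 * μ.real A) * μ.real A = ε / 4 := by field_simp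
    linarith
  have hinv : ∀ k, 0 < 1 - l k := fun k => by linarith [hl2 k]
  have hinv2 : ∀ k, (1 - l k)⁻¹ ≤ 2 := fun k => by
    have := inv_anti₀ (by norm_num : (0 : ℝ) < 1 / 2) (by linarith [hl2 k] : 1 / 2 ≤ 1 - l k)
    simpa using this
  have habs1 : ∀ k, |1 - l k| ≤ 2 := fun k => by
    rw [abs_of_pos (hinv k)]
    linarith [hl0 k]
  have habs : ∀ k, |l k| ≤ 2 := fun k => by
    rw [abs_of_pos (hl0 k)]
    linarith [hl1 k]
  have hsq : ∀ k, l k ^ 2 / 2 ≤ 1 := fun k => by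
    have := pow_le_one₀ (n := 2) (hl0 k).le (hl1 k)
    linarith
  have habsq : ∀ k, |l k ^ 2 / 2| ≤ 2 := fun k => by
    rw [abs_of_nonneg (by positivity)]
    linarith [hsq k]
  -- Contraction scales the net trade `a - g` by `1 - l (idx t)`, which varies with the agent.
  -- Selecting each class in proportion to the inverse factor restores a uniform weight `α`, and the
  -- aggregate over `A` vanishes.
  obtain ⟨B, hBA, hB, hBμ, e, heη, heQ, hei, heint⟩ :=
    hμ.exists_subset_weighted_correction hA (p := fun t => (idx t, E.info t))
      (hidx.prodMk hinfo) (α := fun i => α * (1 - l i.1)⁻¹)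
      (fun i => mul_pos hα0 (inv_pos.2 (hinv _)))
      (fun i => by
        have := mul_le_mul hα2 (hinv2 i.1) (inv_pos.2 (hinv _)).le (by norm_num)
        linarith)
      (h := fun t ω => (1 - l (idx t)) • (E.endow t ω - g t ω))
      (fun ω => hbddY (fun x => 1 - x) (by fun_prop) habs1 ((haA ω).sub (hgA ω)))
      (Q := fun i => i.2)
      (hg.2.mono fun t ht htA ω ω' hω => by
        rw [E.endow_const t ω ω' hω, (mem_privateBundles_iff.1 (ht (hAS htA))).2 ω ω' hω])
      (η := fun i => l i.1 ^ 2 / 2 * r)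
      (fun i => mul_pos (by have := hl0 i.1; positivity) hr0)
      (fun i => mul_le_one₀ (hsq _) hr0.le hr1)
  have hweight : IntegrableOn (fun t => α * (1 - l (idx t))⁻¹) A μ :=
    (hbdd (fun x => (1 - x)⁻¹) (by fun_prop) fun k => by
      rw [abs_of_pos (inv_pos.2 (hinv k))]
      exact hinv2 k).const_mul α |>.integrableOn
  have hB0 : 0 < μ.real B := by
    rw [hBμ]
    exact setIntegral_pos_of_pos hA0 hweight fun t => mul_pos hα0 (inv_pos.2 (hinv _))
  have hB0' : 0 < μ B := by
    simpa [measureReal_def, ENNReal.toReal_pos_iff] using hB0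
  have hBε : μ.real B < ε := by
    refine lt_of_le_of_lt ?_ hαε
    rw [hBμ]
    have := setIntegral_mono hweight (integrable_const (2 * α)) fun t => by
      have := mul_le_mul_of_nonneg_left (hinv2 (idx t)) hα0.le
      linarith
    simpa [mul_comm] using this
  -- Contraction saves `l (idx t) ^ 2 • u` per head. Half is given back to cover the correction `e`,
  -- whose norm is below `s t * r`; the other half is the surplus.
  let s : T → ℝ := fun t => l (idx t) ^ 2 / 2
  have hs0 : ∀ t, 0 < s t := fun t => by
    have := hl0 (idx t)
    positivity
  have hsi : IntegrableOn s B μ := (hbdd (fun x => x ^ 2 / 2) (by fun_prop) habsq).integrableOn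
  let g' : T → Ω → Y := fun t ω => contraction (l (idx t)) u (g t) (E.endow t) ω +
    (s t • u + e (idx t, E.info t) ω)
  have hslack : ∀ t ω, StronglyPos (s t • u + e (idx t, E.info t) ω) := fun t ω =>
    hr _ _ (hs0 t) (heη (idx t, E.info t) ω)
  have hcon0 : ∀ t ∈ B, ∀ ω, 0 ≤ contraction (l (idx t)) u (g t) (E.endow t) ω := fun t ht ω =>
    add_nonneg (smul_nonneg (hinv _).le (hg.1.1 t (hAS (hBA ht)) ω))
      (smul_nonneg (hl0 _).le ((hidxM t (hBA ht)).2.1 ω).nonneg)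
  have hdiff : ∀ t ω, E.endow t ω - g' t ω =
      ((1 - l (idx t)) • (E.endow t ω - g t ω) - e (idx t, E.info t) ω) + s t • u := by
    intro t ω
    simp only [g', contraction, s]
    module
  have hdi : ∀ ω, IntegrableOn (fun t => (1 - l (idx t)) • (E.endow t ω - g t ω) -
      e (idx t, E.info t) ω) B μ := fun ω =>
    (hbddY (fun x => 1 - x) (by fun_prop) habs1
      (((haA ω).sub (hgA ω)).mono_set hBA)).sub (hei ω).integrableOn
  refine ⟨B, hBε, ⟨hB, hB0'⟩, g', ⟨⟨fun t ht ω => ?_, fun ω => ?_⟩, ?_⟩,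
    ⟨(∫ t in B, s t ∂μ) • u, hu.smul (setIntegral_pos_of_pos hB0' hsi hs0), fun ω => ?_⟩, ?_⟩
  · exact add_nonneg (hcon0 t ht ω) (hslack t ω).nonneg
  · have h1 := ((haA ω).mono_set hBA).sub ((hdi ω).add (hsi.smul_const u))
    refine h1.congr (Filter.Eventually.of_forall fun t => ?_)
    have := hdiff t ω
    simp only [Pi.sub_apply, Pi.add_apply]
    rw [← this]
    abel
  · filter_upwards [hg.2] with t ht htB
    have htS := hAS (hBA htB)
    refine mem_privateBundles_iff.2
      ⟨fun ω => add_nonneg (hcon0 t htB ω) (hslack t ω).nonneg, fun ω ω' hω => ?_⟩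
    simp only [g', contraction, E.endow_const t ω ω' hω,
      (mem_privateBundles_iff.1 (ht htS)).2 ω ω' hω, heQ (idx t, E.info t) ω ω' hω]
  · simp only [hdiff]
    rw [integral_add (hdi ω) (hsi.smul_const u), heint ω, integral_smul_const]
    have : ∀ t, (α * (1 - l (idx t))⁻¹) • (1 - l (idx t)) • (E.endow t ω - g t ω) =
        α • (E.endow t ω - g t ω) := fun t => by
      rw [smul_smul, mul_assoc, inv_mul_cancel₀ (hinv _).ne', mul_one]
    simp only [this]
    rw [integral_smul, integral_sub (haA ω) (hgA ω), setIntegral_congr_set hAae,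
      setIntegral_congr_set hAae, hgfeas ω, sub_self, smul_zero, zero_add]
  · refine Filter.Eventually.of_forall fun t ht => ?_
    refine (hidxM t (hBA ht)).2.2.trans_le (expUtility_mono fun ω => ?_)
    exact hA3.utility_le hA2 ⟨u, hu⟩ t ω (hcon0 t ht ω)
      (le_add_of_nonneg_right (hslack t ω).nonneg)

/-! ### Enlarging to a coalition of prescribed size. -/

/-- A strongly blocking coalition can be enlarged to a blocking coalition of any size. -/
theorem StronglyBlocks.exists_blocks [CompleteSpace Y] [IsOrderedAddMonoid Y]
    [IsOrderedModule ℝ Y] [IsFiniteMeasure μ] [Nonempty Ω] (hμ : μ.Atomless)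
    (hA1 : E.MeasurableCharacteristics)
    (hA3 : E.MonotoneUtilities) (hA4 : E.ConcaveUtilities)
    {f : T → Ω → Y} (hf : E.IsAllocation Set.univ f) (hffeas : E.IsExactlyFeasible Set.univ f)
    {S : Set T} (hS : E.StronglyBlocks S f) {ε : ℝ} (hε : μ.real S < ε)
    (hε' : ε < μ.real Set.univ) : ∃ S', μ.real S' = ε ∧ E.NYPrivatelyBlocks S' f := by
  obtain ⟨⟨hSm, hS0⟩, g, hg, ⟨u, hu, hgu⟩, hgV⟩ := hS
  obtain ⟨r, hr0, hr1, hr⟩ := hu.exists_radius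
  have hcompl : μ.real Sᶜ = μ.real Set.univ - μ.real S := measureReal_compl hSm
  have hR0 : 0 < μ.real Sᶜ := by linarith
  obtain ⟨α, hα0, hα1, hαμ⟩ : ∃ α : ℝ, 0 < α ∧ α < 1 ∧ α * μ.real Sᶜ = ε - μ.real S :=
    ⟨(ε - μ.real S) / μ.real Sᶜ, div_pos (by linarith) hR0, (div_lt_one hR0).2 (by linarith),
      div_mul_cancel₀ _ hR0.ne'⟩
  have hC0 : 0 < ε - μ.real S := by linarith
  -- The set `C` chosen below has measure `ε - μ.real S`, so `k • u` per head on `C` uses exactly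
  -- the surplus `(1 - α) • u` left by `S`.
  obtain ⟨k, hk0, hk⟩ : ∃ k : ℝ, 0 < k ∧ (ε - μ.real S) * k = 1 - α :=
    ⟨(1 - α) / (ε - μ.real S), div_pos (by linarith) hC0, mul_div_cancel₀ _ hC0.ne'⟩
  let _ : MeasurableSpace (Setoid Ω) := ⊤
  have := finite_setoid Ω
  have hfi : ∀ ω, Integrable (fun t => f t ω) μ := fun ω => integrableOn_univ.1 (hf.1.2 ω)
  have hfQ : ∀ᵐ t ∂μ, ∀ ω ω', (E.info t) ω ω' → f t ω = f t ω' :=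
    hf.2.mono fun t ht => (mem_privateBundles_iff.1 (ht trivial)).2
  have hafi : ∀ ω, Integrable (fun t => E.endow t ω - f t ω) μ := fun ω =>
    (E.endow_integrable ω).sub (hfi ω)
  obtain ⟨C, hCS, hC, hCμ, e, heη, heQ, hei, heint⟩ :=
    hμ.exists_subset_weighted_correction hSm.compl (p := E.info) (measurable_info hA1)
      (α := fun _ => α) (fun _ => hα0) (fun _ => hα1.le)
      (h := fun t ω => E.endow t ω - f t ω) (fun ω => (hafi ω).integrableOn) (Q := id)
      (hfQ.mono fun t ht _ ω ω' hω => by rw [E.endow_const t ω ω' hω, ht ω ω' hω])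
      -- The bound `k * r` keeps `k • u + e` interior; the bound `1` serves integrability.
      (η := fun _ => min (k * r) 1) (fun _ => lt_min (mul_pos hk0 hr0) one_pos)
      (fun _ => min_le_right _ _)
  have hCμ' : μ.real C = ε - μ.real S := by
    rw [hCμ, setIntegral_const, smul_eq_mul, mul_comm, hαμ]
  have hdisj : Disjoint S C := Set.disjoint_left.2 fun t ht htC => hCS htC ht
  have hunion : μ.real (S ∪ C) = ε := by
    rw [measureReal_union hdisj hC, hCμ']
    ring
  have hslack : ∀ t ω, StronglyPos (k • u + e (E.info t) ω) := fun t ω =>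
    hr _ _ hk0 ((heη _ ω).trans_le (min_le_left _ _))
  let gS : T → Ω → Y := fun t ω => (1 - α) • g t ω + α • f t ω
  let gC : T → Ω → Y := fun t ω => f t ω + (k • u + e (E.info t) ω)
  have hgSi : ∀ ω, IntegrableOn (fun t => gS t ω) S μ := fun ω =>
    ((hg.1.2 ω).smul (1 - α)).add ((hfi ω).integrableOn.smul α)
  have hgCi : ∀ ω, IntegrableOn (fun t => gC t ω) C μ := fun ω =>
    (hfi ω).integrableOn.add ((integrable_const _).add (hei ω).integrableOn)
  classical
  let G : T → Ω → Y := S.piecewise gS gC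
  have hGS : ∀ t ∈ S, G t = gS t := fun t ht => Set.piecewise_eq_of_mem _ _ _ ht
  have hGC : ∀ t ∈ C, G t = gC t := fun t ht => Set.piecewise_eq_of_notMem _ _ _ (hCS ht)
  have hGiS : ∀ ω, IntegrableOn (fun t => G t ω) S μ := fun ω =>
    (hgSi ω).congr_fun (fun t ht => by rw [hGS t ht]) hSm
  have hGiC : ∀ ω, IntegrableOn (fun t => G t ω) C μ := fun ω =>
    (hgCi ω).congr_fun (fun t ht => by rw [hGC t ht]) hC
  have hG0 : ∀ t ∈ S ∪ C, ∀ ω, 0 ≤ G t ω := by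
    rintro t (ht | ht) ω
    · rw [hGS t ht]
      exact add_nonneg (smul_nonneg (by linarith) (hg.1.1 t ht ω))
        (smul_nonneg hα0.le (hf.1.1 t trivial ω))
    · rw [hGC t ht]
      exact add_nonneg (hf.1.1 t trivial ω) (hslack t ω).nonneg
  have hintS : ∀ ω, ∫ t in S, (E.endow t ω - G t ω) ∂μ =
      (1 - α) • u + α • ∫ t in S, (E.endow t ω - f t ω) ∂μ := by
    intro ω
    have h1 : IntegrableOn (fun t => (1 - α) • (E.endow t ω - g t ω)) S μ :=
      ((E.endow_integrable ω).integrableOn.sub (hg.1.2 ω)).smul _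
    have h2 : IntegrableOn (fun t => α • (E.endow t ω - f t ω)) S μ :=
      (hafi ω).integrableOn.smul _
    rw [← hgu ω, ← integral_smul, ← integral_smul, ← integral_add h1 h2]
    refine setIntegral_congr_fun hSm fun t ht => ?_
    simp only [hGS t ht, gS]
    module
  have hintC : ∀ ω, ∫ t in C, (E.endow t ω - G t ω) ∂μ =
      α • ∫ t in Sᶜ, (E.endow t ω - f t ω) ∂μ - (1 - α) • u := by
    intro ω
    have hconst : (1 - α) • u = ∫ _ in C, k • u ∂μ := by
      rw [setIntegral_const, smul_smul, hCμ', hk]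
    have h1 : IntegrableOn (fun t => E.endow t ω - f t ω - e (E.info t) ω) C μ :=
      (hafi ω).integrableOn.sub (hei ω).integrableOn
    rw [hconst, ← integral_smul, ← heint ω, ← integral_sub h1 (integrable_const _)]
    refine setIntegral_congr_fun hC fun t ht => ?_
    simp only [hGC t ht, gC]
    abel
  refine ⟨S ∪ C, hunion, ⟨hSm.union hC, hS0.trans_le (measure_mono Set.subset_union_left)⟩, G,
    ⟨⟨hG0, fun ω => (hGiS ω).union (hGiC ω)⟩, ?_⟩, fun ω => ?_, ?_⟩
  · filter_upwards [hg.2, hfQ] with t htg htf ht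
    refine mem_privateBundles_iff.2 ⟨hG0 t ht, fun ω ω' hω => ?_⟩
    rcases ht with ht | ht
    · simp only [hGS t ht, gS, (mem_privateBundles_iff.1 (htg ht)).2 ω ω' hω, htf ω ω' hω]
    · simp only [hGC t ht, gC, htf ω ω' hω, heQ (E.info t) ω ω' hω]
  · have hai := (E.endow_integrable ω).integrableOn (s := S ∪ C)
    have hGi : IntegrableOn (fun t => G t ω) (S ∪ C) μ := (hGiS ω).union (hGiC ω)
    refine (sub_eq_zero.1 ?_).symm
    have h1 : IntegrableOn (fun t => E.endow t ω - G t ω) S μ :=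
      (E.endow_integrable ω).integrableOn.sub (hGiS ω)
    have h2 : IntegrableOn (fun t => E.endow t ω - G t ω) C μ :=
      (E.endow_integrable ω).integrableOn.sub (hGiC ω)
    rw [← integral_sub hai hGi, setIntegral_union hdisj hC h1 h2, hintS, hintC]
    -- The surplus terms cancel, leaving `α` times the aggregate excess of the endowment over `f`,
    -- which is zero.
    have htot : ∫ t in S, (E.endow t ω - f t ω) ∂μ + ∫ t in Sᶜ, (E.endow t ω - f t ω) ∂μ = 0 := by
      rw [integral_add_compl hSm (hafi ω), integral_sub (E.endow_integrable ω) (hfi ω)]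
      have := hffeas ω
      rw [setIntegral_univ, setIntegral_univ] at this
      rw [this, sub_self]
    calc _ = α • (∫ t in S, (E.endow t ω - f t ω) ∂μ + ∫ t in Sᶜ, (E.endow t ω - f t ω) ∂μ) := by
          module
      _ = 0 := by rw [htot, smul_zero]
  · filter_upwards [hgV] with t htV ht
    rcases ht with ht | ht
    · rw [hGS t ht]
      have h1 := hA4.expUtility_le t (hg.1.1 t ht) (hf.1.1 t trivial) hα0.le hα1.le
      -- Strictness comes from `1 - α > 0`, not from strict concavity.
      have h2 := mul_lt_mul_of_pos_left (htV ht) (sub_pos.2 hα1)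
      exact lt_of_lt_of_le (by linarith) h1
    · rw [hGC t ht]
      exact expUtility_strictMono fun ω => hA3 t ω _ _ (hf.1.1 t trivial ω) (hslack t ω)

/-- Without states all expected utilities are the empty sum `0`, and no agent can strictly improve.
-/
theorem NYPrivatelyBlocks.nonempty_states {S : Set T} {f : T → Ω → Y}
    (hS : E.NYPrivatelyBlocks S f) : Nonempty Ω := by
  obtain ⟨⟨-, hS0⟩, g, -, -, hgV⟩ := hS
  by_contra hΩ
  rw [not_nonempty_iff] at hΩ
  refine hS0.ne' (measure_eq_zero_iff_ae_notMem.2 (hgV.mono fun t ht htS => ?_))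
  simpa [expUtility] using ht htS

end AsymEconomy

/-! ### The theorem. -/

theorem mainTheorem2 {Ω T Y : Type*} [Fintype Ω] [MeasurableSpace T]
    [NormedAddCommGroup Y] [NormedSpace ℝ Y] [CompleteSpace Y]
    [PartialOrder Y] [IsOrderedAddMonoid Y] [IsOrderedModule ℝ Y]
    (hY : (interior (Set.Ici (0 : Y))).Nonempty)
    (μ : MeasureTheory.Measure T) [MeasureTheory.IsFiniteMeasure μ] [μ.IsComplete]
    (hμ : μ.Atomless)
    (E : AsymEconomy Ω T Y μ)
    (hA1 : E.MeasurableCharacteristics)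
    (hA2 : E.CaratheodoryUtilities)
    (hA3 : E.MonotoneUtilities)
    (hA4' : E.ConcaveUtilities)
    (hA5 : E.StrictlyPositiveEndowments)
    (f : T → Ω → Y)
    (hf : E.IsAllocation Set.univ f)
    (hf_feas : E.IsExactlyFeasible Set.univ f)
    (hf_core : f ∉ E.NYPrivateCore)
    (ε : ℝ) (hε : 0 < ε) (hε' : ε < μ.real Set.univ) :
    ∃ S : Set T, μ.real S = ε ∧ E.NYPrivatelyBlocks S f := by
  obtain ⟨S, hS⟩ : ∃ S, E.NYPrivatelyBlocks S f := by
    by_contra! h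
    exact hf_core ⟨hf, hf_feas, h⟩
  have := hS.nonempty_states
  obtain ⟨S', hS'ε, hS'⟩ := hS.exists_stronglyBlocks hY hμ hA1 hA2 hA3 hA5 hf hε
  exact hS'.exists_blocks hμ hA1 hA3 hA4' hf hf_feas hS'ε hε'
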